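/- Let $X_t=(A_t,B_t)_{t\ge 0}$ be a time-homogeneous strong Markov process with right-continuous paths and state space $E\subseteq\mathbb R^2$: it is given by a measurable space $\Omega$ with $\sigma$-algebra $\sigma(X_s:s\ge 0)$, shift operators $\theta_t$ on $\Omega$ with $X_s\circ\theta_t=X_{t+s}$, and a measurable family of probability measures $(P^x)_{x\in E}$ with $P^x[X_0=x]=1$, such that the strong Markov property \[ P^\nu\big[\Gamma\cap\{\tau<\infty\}\cap\theta_\tau^{-1}\Lambda\big]=E^\nu\big[1_{\Gamma\cap\{\tau<\infty\}}\,P^{X_\tau}(\Lambda)\big] \] holds for every initial law $\nu$ (where $P^\nu=\int P^x\,\nu(dx)$), every stopping time $\tau$ of the right-continuous filtration $\mathcal F_{t+}=\bigcap_{u>t}\sigma(X_s:s\le u)$, every $\Gamma\in\mathcal F_{\tau+}$ and every event $\Lambda$. (In particular $X$ is Markov and satisfies the Blumenthal--Getoor $0$-$1$ law; $B$ may for instance be a Brownian motion.) For $R\subseteq\mathbb R^2$ let $\tau_R=\inf\{t\ge 0:(A_t,B_t)\in R\}\in[0,\infty]$. The fine closure of $R$ is $R^*=R\cup\{x\in E: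 P^x[\tau_R=0]=1\}$, and $R$ is finely closed if $R^*=R$. A barrier is a set $R\subseteq\mathbb R^2$ such that $(s,x)\in R$ implies $(t,x)\in R$ for all $t>s$. A random time is called a stopping time if it is one for the usual augmentation of $(\mathcal F_{t+})_{t\ge0}$, that is, if for every initial law $\nu$ and every $t\ge0$ the event $\{\tau\le t\}$ coincides, up to a $P^\nu$-null set, with an event of $\mathcal F_{t+}$. Fix an initial law $\nu$ on $E$ and a probability measure $\mu$ on $\mathbb R$. Let $R$ and $S$ be two finely closed Borel barriers such that $\tau_R$ and $\tau_S$ are stopping times which both embed $\mu$ under $P^\nu$, i.e. $\tau_R,\tau_S<\infty$ $P^\nu$-almost surely and $B_{\tau_R}\sim\mu$, $B_{\tau_S}\sim\mu$ under $P^\nu$. Then $\tau_{R\cup S}$ is a stopping time which also embeds $\mu$ under $P^\nu$ (it is $P^\nu$-almost surely finite and $B_{\tau_{R\cup S}}\sim\mu$), and \[ \tau_{R\cup S}=\tau_R\wedge\tau_S \] (for every $\omega$, hence in particular almost surely). -/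

import Mathlib

open MeasureTheory ProbabilityTheory
open scoped NNReal ENNReal

/-- A time-homogeneous Markov process `X_t = (A_t, B_t)` in the plane, with state space `E ⊆ ℝ²`:
a sample space `Ω` whose σ-algebra is generated by `X`, right-continuous paths, shift operators
`θ_t` on `Ω`, and a measurable family `x ↦ P x` of probability measures under which `X` starts
at `x ∈ E`, such that the strong Markov property holds with respect to the right-continuous
filtration `𝓕ₜ₊ = ⋂_{u > t} σ(X_s : s ≤ u)`. With constant times, the last property contains the
ordinary Markov property, and with the time `0` it contains the Blumenthal-Getoor zero-one law. -/
structure JointMarkovProcess (E : Set (ℝ × ℝ)) (Ω : Type*) [mΩ : MeasurableSpace Ω] where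
  /-- the process, `X t ω = (A_t(ω), B_t(ω))` -/
  X : ℝ≥0 → Ω → E
  stronglyMeasurable : ∀ t, StronglyMeasurable (X t)
  generates : mΩ = ⨆ t, MeasurableSpace.comap (X t) inferInstance
  rightContinuous : ∀ ω t, ContinuousWithinAt (fun s => X s ω) (Set.Ici t) t
  /-- the shift operators -/
  θ : ℝ≥0 → Ω → Ω
  shift : ∀ s t ω, X s (θ t ω) = X (t + s) ω
  /-- the law of the process started at a given point -/
  P : Kernel E Ω
  markovKernel : IsMarkovKernel P
  start : ∀ x, ∀ᵐ ω ∂P x, X 0 ω = x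
  /-- `P^ν(Γ, τ < ∞, θ_τ ∈ Λ) = E^ν[1_Γ 1_{τ < ∞} P^{X_τ}(Λ)]` for all initial laws `ν`, stopping
  times `τ` and events `Γ ∈ 𝓕_{τ+}` -/
  strongMarkov : ∀ (ν : Measure E) [IsProbabilityMeasure ν] (τ : Ω → WithTop ℝ≥0)
    (hτ : IsStoppingTime (Filtration.natural X stronglyMeasurable).rightCont τ) (Γ Λ : Set Ω),
    MeasurableSet[hτ.measurableSpace] Γ → MeasurableSet Λ →
    ν.bind P (Γ ∩ {ω | τ ω ≠ ⊤} ∩ {ω | θ (τ ω).untopA ω ∈ Λ}) =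
      ∫⁻ ω in Γ ∩ {ω | τ ω ≠ ⊤}, P (X (τ ω).untopA ω) Λ ∂(ν.bind P)

namespace JointMarkovProcess

variable {E : Set (ℝ × ℝ)} {Ω : Type*} [MeasurableSpace Ω] (M : JointMarkovProcess E Ω)

/-- The first component `A_t`. -/
def A (t : ℝ≥0) (ω : Ω) : ℝ := (M.X t ω : ℝ × ℝ).1

/-- The second component `B_t`. -/
def B (t : ℝ≥0) (ω : Ω) : ℝ := (M.X t ω : ℝ × ℝ).2

/-- The law of the process with initial distribution `(A_0, B_0) ∼ ν`. -/
noncomputable def law (ν : Measure E) : Measure Ω := ν.bind M.P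

/-- The hitting time `τ_R = inf {t ≥ 0 : (A_t, B_t) ∈ R}`, equal to `⊤` if `R` is never hit. -/
noncomputable def hit (R : Set (ℝ × ℝ)) : Ω → WithTop ℝ≥0 :=
  hittingAfter (fun t ω => (M.A t ω, M.B t ω)) R 0

/-- The right-continuous filtration generated by the process. -/
noncomputable def filtration : Filtration ℝ≥0 (inferInstance : MeasurableSpace Ω) :=
  (Filtration.natural M.X M.stronglyMeasurable).rightCont

/-- Stopping times of the usual augmentation of `M.filtration`: for each initial law `ν`, every
`{τ ≤ t}` agrees with some event of `𝓕ₜ₊` up to a null set of the law with initial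
distribution `ν`. -/
def IsAugmentedStoppingTime (τ : Ω → WithTop ℝ≥0) : Prop :=
  ∀ ν : Measure E, IsProbabilityMeasure ν → ∀ t : ℝ≥0,
    ∃ Λ : Set Ω, MeasurableSet[M.filtration t] Λ ∧ {ω | τ ω ≤ t} =ᵐ[M.law ν] Λ

/-- The fine closure `R ∪ {x : P^x[τ_R = 0] = 1}` of `R`. -/
def fineClosure (R : Set (ℝ × ℝ)) : Set (ℝ × ℝ) :=
  R ∪ {x | ∃ hx : x ∈ E, ∀ᵐ ω ∂M.P ⟨x, hx⟩, M.hit R ω = 0}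

/-- `R` is finely closed with respect to the process. -/
def IsFinelyClosed (R : Set (ℝ × ℝ)) : Prop := M.fineClosure R = R

/-- Started from `ν`, the time `τ` is almost surely finite and `B_τ` has law `μ`. -/
def Embeds (ν : Measure E) (τ : Ω → WithTop ℝ≥0) (μ : Measure ℝ) : Prop :=
  (∀ᵐ ω ∂M.law ν, τ ω ≠ ⊤) ∧ HasLaw (stoppedValue M.B τ) μ (M.law ν)

end JointMarkovProcess

/-- A (Root) barrier: if `(s, x) ∈ R`, then `(t, x) ∈ R` for all `t > s`. -/
def IsBarrier (R : Set (ℝ × ℝ)) : Prop :=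
  ∀ s t x : ℝ, s < t → (s, x) ∈ R → (t, x) ∈ R

/-! Let `K` be the set of levels at which `S` sticks out of `R`. Fine closedness and the strong
Markov property put the process a.s. inside each barrier at its hitting time
(`IsFinelyClosed.ae_mem_of_hit`). If `B` at `τ_R` lies in `K`, the point reached in `R` also lies in
`S`, so `τ_S ≤ τ_R`; if `B` at `τ_S` lies outside `K`, the point reached in `S` also lies in `R`, so
`τ_R ≤ τ_S`.

Hence `B_{τ_R} ∈ K` a.s. forces `B_{τ_S} ∈ K`, as otherwise the two times would coincide. Both
events have probability `μ(K)`, so they agree a.s. The minimum is thus `τ_S` on this event and `τ_R`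
off it, and its law is `μ` restricted to `K` plus `μ` restricted to the complement
(`HasLaw.switch`). -/

namespace IsBarrier

/-- The levels at which the barrier `S` sticks out of the barrier `R` form a Borel set: the vertical
gap contains either a rational point or the left endpoint of the section of `R`. -/
theorem measurableSet_gap {R S : Set (ℝ × ℝ)} (hRm : MeasurableSet R) (hSm : MeasurableSet S)
    (hR : IsBarrier R) (hS : IsBarrier S) : MeasurableSet {x : ℝ | ∃ t, (t, x) ∈ S \ R} := by
  classical
  -- The left endpoint of the section of `R`, as a countable infimum so that it is measurable. Where
  -- it is infinite, `toReal` gives a junk value, harmless because membership in `S \ R` is tested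
  -- anyway.
  set c : ℝ → EReal := fun x => ⨅ q : ℚ, if ((q : ℝ), x) ∈ R then ((q : ℝ) : EReal) else ⊤
  have hcm : Measurable c := Measurable.iInf fun q =>
    Measurable.ite (measurable_prodMk_left hRm) measurable_const measurable_const
  have hgap : {x : ℝ | ∃ t, (t, x) ∈ S \ R} =
      (⋃ q : ℚ, {x : ℝ | ((q : ℝ), x) ∈ S \ R}) ∪ {x : ℝ | ((c x).toReal, x) ∈ S \ R} := by
    ext x
    simp only [Set.mem_ofPred_eq, Set.mem_union, Set.mem_iUnion]
    refine ⟨fun ⟨t, ht⟩ => ?_, ?_⟩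
    -- Without a rational point in the gap, `R` contains every rational above `t` and none below, so
    -- `t` is the endpoint `c x`.
    · by_contra! hx
      refine hx.2 ?_
      have hq : ∀ q : ℚ, t < q → ((q : ℝ), x) ∈ R := fun q hq => by
        by_contra hn
        exact hx.1 q ⟨hS _ _ _ hq ht.1, hn⟩
      have hq' : ∀ q : ℚ, ((q : ℝ), x) ∈ R → t ≤ q := fun q hqR => by
        by_contra! hlt
        exact ht.2 (hR _ _ _ hlt hqR)
      have hct : c x = t := by
        refine le_antisymm (le_of_forall_gt fun a ha => ?_) (le_iInf fun q => ?_)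
        · obtain ⟨q, htq, hqa⟩ := EReal.lt_iff_exists_rat_btwn.1 ha
          refine (iInf_le _ q).trans_lt ?_
          rwa [if_pos (hq q (EReal.coe_lt_coe_iff.1 htq))]
        · split_ifs with h
          exacts [EReal.coe_le_coe_iff.2 (hq' q h), le_top]
      rwa [hct, EReal.toReal_coe]
    · rintro (⟨q, hq⟩ | h)
      exacts [⟨_, hq⟩, ⟨_, h⟩]
  rw [hgap]
  refine (MeasurableSet.iUnion fun q => measurable_prodMk_left (hSm.diff hRm)).union ?_
  exact (hcm.ereal_toReal.prodMk measurable_id) (hSm.diff hRm)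

end IsBarrier

/-- A right-continuous process with measurable marginals, evaluated at a measurable random time,
is measurable. -/
theorem measurable_eval_of_rightContinuous {Ω β : Type*} [MeasurableSpace Ω] [TopologicalSpace β]
    [TopologicalSpace.PseudoMetrizableSpace β] [MeasurableSpace β] [BorelSpace β]
    {X : ℝ≥0 → Ω → β} (hX : ∀ t, Measurable (X t))
    (hc : ∀ ω t, ContinuousWithinAt (fun s => X s ω) (Set.Ici t) t)
    {σ : Ω → ℝ≥0} (hσ : Measurable σ) : Measurable fun ω => X (σ ω) ω := by
  have hcount : ∀ (d : ℕ → ℝ≥0) (k : Ω → ℕ), Measurable k → Measurable fun ω => X (d (k ω)) ω := by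
    intro d k hk
    have hd : Measurable fun p : ℕ × Ω => X (d p.1) p.2 :=
      measurable_from_prod_countable_right fun i => hX (d i)
    exact hd.comp (hk.prodMk measurable_id)
  -- Approximations of `σ` from above with countably many values; approaching from the right is what
  -- right continuity requires.
  have hX' : ∀ n : ℕ, Measurable fun ω => X ((⌈σ ω * (n + 1)⌉₊ : ℝ≥0) / (n + 1)) ω := fun n =>
    hcount (fun k => (k : ℝ≥0) / (n + 1)) (fun ω => ⌈σ ω * (n + 1)⌉₊)
      (Nat.measurable_ceil.comp (hσ.mul_const _))
  refine measurable_of_tendsto_metrizable hX' (tendsto_pi_nhds.2 fun ω => ?_)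
  refine (hc ω (σ ω)).tendsto.comp (tendsto_nhdsWithin_iff.2 ⟨?_, .of_forall fun n => ?_⟩)
  · have hlim : Filter.Tendsto (fun n : ℕ => σ ω + 1 / ((n : ℝ≥0) + 1)) Filter.atTop
        (nhds (σ ω)) := by
      simpa using tendsto_const_nhds.add (tendsto_one_div_add_atTop_nhds_zero_nat (𝕜 := ℝ≥0))
    refine tendsto_of_tendsto_of_tendsto_of_le_of_le tendsto_const_nhds hlim (fun n => ?_)
      (fun n => ?_)
    · exact (le_div_iff₀ (by positivity)).2 (Nat.le_ceil _)
    · refine (div_le_iff₀ (by positivity)).2 ?_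
      rw [add_mul, one_div, inv_mul_cancel₀ (by positivity)]
      exact (Nat.ceil_lt_add_one (zero_le (a := σ ω * ((n : ℝ≥0) + 1)))).le
  · exact Set.mem_Ici.2 ((le_div_iff₀ (by positivity)).2 (Nat.le_ceil _))

/-! ### Hitting times and entry into finely closed sets -/

namespace JointMarkovProcess

variable {E : Set (ℝ × ℝ)} {Ω : Type*} [MeasurableSpace Ω] (M : JointMarkovProcess E Ω)

theorem hit_le_of_mem {R : Set (ℝ × ℝ)} {ω : Ω} {t : ℝ≥0} (h : (M.X t ω : ℝ × ℝ) ∈ R) :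
    M.hit R ω ≤ t :=
  not_lt.1 fun hlt => notMem_of_lt_hittingAfter hlt zero_le h

theorem le_hit_iff {R : Set (ℝ × ℝ)} {ω : Ω} {a : WithTop ℝ≥0} :
    a ≤ M.hit R ω ↔ ∀ t : ℝ≥0, (M.X t ω : ℝ × ℝ) ∈ R → a ≤ t := by
  classical
  refine ⟨fun h t ht => h.trans (M.hit_le_of_mem ht), fun h => ?_⟩
  rw [hit, hittingAfter_def]
  dsimp only
  split_ifs with hex
  · obtain ⟨s, hs⟩ := hex
    lift a to ℝ≥0 using ((h s hs.2).trans_lt (WithTop.coe_lt_top s)).ne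
    exact WithTop.coe_le_coe.2 (le_csInf ⟨s, hs⟩ fun t ht => WithTop.coe_le_coe.1 (h t ht.2))
  · exact le_top

theorem hit_le_of_mem_untopA {R : Set (ℝ × ℝ)} {ω : Ω} {a : WithTop ℝ≥0} (ha : a ≠ ⊤)
    (h : (M.X a.untopA ω : ℝ × ℝ) ∈ R) : M.hit R ω ≤ a := by
  lift a to ℝ≥0 using ha
  exact M.hit_le_of_mem h

theorem hit_le_hit_of_subset {R S : Set (ℝ × ℝ)} (h : R ⊆ S) (ω : Ω) :
    M.hit S ω ≤ M.hit R ω := by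
  exact M.le_hit_iff.2 fun t ht => M.hit_le_of_mem (h ht)

theorem hit_union (R S : Set (ℝ × ℝ)) (ω : Ω) :
    M.hit (R ∪ S) ω = min (M.hit R ω) (M.hit S ω) := by
  refine le_antisymm (le_min (M.hit_le_hit_of_subset Set.subset_union_left ω)
    (M.hit_le_hit_of_subset Set.subset_union_right ω)) ?_
  refine M.le_hit_iff.2 fun t ht => ?_
  rcases ht with ht | ht
  · exact (min_le_left _ _).trans (M.hit_le_of_mem ht)
  · exact (min_le_right _ _).trans (M.hit_le_of_mem ht)

/-- At the time of hitting `R` the shifted path hits `R` at once. -/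
theorem hit_shift_hit {R : Set (ℝ × ℝ)} {ω : Ω} (h : M.hit R ω ≠ ⊤) :
    M.hit R (M.θ (M.hit R ω).untopA ω) ≤ 0 := by
  obtain ⟨t, ht⟩ := WithTop.ne_top_iff_exists.1 h
  rw [← ht]
  change M.hit R (M.θ t ω) ≤ 0
  by_contra! hpos
  -- If the shifted path avoided `R` before some `a > 0`, the original path would avoid it before `t
  -- + a`. The shifted hitting time may be `⊤`, hence the finite lower bound `a`.
  obtain ⟨a, ha, hap⟩ : ∃ a : ℝ≥0, 0 < a ∧ (a : WithTop ℝ≥0) ≤ M.hit R (M.θ t ω) := by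
    induction hm : M.hit R (M.θ t ω) with
    | top => exact ⟨1, one_pos, le_top⟩
    | coe a => exact ⟨a, WithTop.coe_lt_coe.1 (hm ▸ hpos), le_rfl⟩
  have hle : ((t + a : ℝ≥0) : WithTop ℝ≥0) ≤ M.hit R ω := by
    refine M.le_hit_iff.2 fun s hs => WithTop.coe_le_coe.2 ?_
    have hts : t ≤ s := WithTop.coe_le_coe.1 (ht.trans_le (M.hit_le_of_mem hs))
    have has : a ≤ s - t := by
      refine WithTop.coe_le_coe.1 (M.le_hit_iff.1 hap (s - t) ?_)
      rwa [M.shift, add_tsub_cancel_of_le hts]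
    exact (le_tsub_iff_left hts).1 has
  rw [← ht] at hle
  exact (lt_add_of_pos_right t ha).not_ge (WithTop.coe_le_coe.1 hle)

variable {M}

/-- For a fixed initial law, an augmented stopping time is a.s. equal to a stopping time. -/
theorem IsAugmentedStoppingTime.exists_isStoppingTime {σ : Ω → WithTop ℝ≥0}
    (hσ : M.IsAugmentedStoppingTime σ) (ν : Measure E) [hν : IsProbabilityMeasure ν] :
    ∃ τ : Ω → WithTop ℝ≥0, IsStoppingTime M.filtration τ ∧ τ =ᵐ[M.law ν] σ := by
  classical
  have : M.filtration.IsRightContinuous := by unfold filtration; infer_instance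
  choose Λ hΛm hΛ using hσ ν hν
  -- Only countably many events `Λ` are used, so their exceptional sets can be discarded together;
  -- right continuity of the filtration makes the infimum a stopping time.
  refine ⟨fun ω => ⨅ q : ℚ, if ω ∈ Λ (Real.toNNReal q) then (Real.toNNReal q : WithTop ℝ≥0) else ⊤,
    IsStoppingTime.iInf fun q t => ?_, ?_⟩
  · by_cases hq : Real.toNNReal q ≤ t
    · convert M.filtration.mono hq _ (hΛm (Real.toNNReal q)) using 1
      ext ω
      refine ⟨fun h => ?_, fun h => ?_⟩
      · by_contra hn
        rw [Set.mem_ofPred_eq, if_neg hn] at h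
        exact WithTop.not_top_le_coe t h
      · rw [Set.mem_ofPred_eq, if_pos h]
        exact WithTop.coe_le_coe.2 hq
    · convert MeasurableSet.empty using 1
      ext ω
      refine iff_of_false (fun h => ?_) (Set.notMem_empty ω)
      rw [Set.mem_ofPred_eq] at h
      split_ifs at h with hn
      exacts [hq (WithTop.coe_le_coe.1 h), WithTop.not_top_le_coe t h]
  · filter_upwards [ae_all_iff.2 fun q : ℚ => hΛ (Real.toNNReal q)] with ω hω
    have hω' : ∀ q : ℚ, ω ∈ Λ (Real.toNNReal q) ↔ σ ω ≤ Real.toNNReal q := fun q =>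
      (iff_of_eq (hω q)).symm
    simp only [hω']
    refine le_antisymm (le_of_forall_gt fun c hc => ?_) (le_iInf fun q => ?_)
    · obtain ⟨s, hs⟩ := WithTop.ne_top_iff_exists.1 hc.ne_top
      obtain ⟨u, hsu, huc⟩ : ∃ u : ℝ≥0, s < u ∧ (u : WithTop ℝ≥0) ≤ c := by
        induction c with
        | top => exact ⟨s + 1, by simp, le_top⟩
        | coe c => exact ⟨c, by rw [← hs] at hc; exact_mod_cast hc, le_rfl⟩
      obtain ⟨q, -, hq, hqu⟩ := (NNReal.lt_iff_exists_rat_btwn s u).1 hsu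
      refine (iInf_le _ q).trans_lt ?_
      rw [if_pos (by rw [← hs]; exact_mod_cast hq.le)]
      exact (WithTop.coe_lt_coe.2 hqu).trans_le huc
    · split_ifs with h
      exacts [h, le_top]

variable (M)

instance isMarkovKernel_P : IsMarkovKernel M.P := M.markovKernel

instance isProbabilityMeasure_law (ν : Measure E) [IsProbabilityMeasure ν] :
    IsProbabilityMeasure (M.law ν) := by
  unfold law; infer_instance

theorem measurable_X_untopA {τ : Ω → WithTop ℝ≥0} (hτ : IsStoppingTime M.filtration τ) :
    Measurable fun ω => M.X (τ ω).untopA ω :=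
  measurable_eval_of_rightContinuous (fun t => (M.stronglyMeasurable t).measurable)
    M.rightContinuous hτ.measurable'.untopA

/-- The strong Markov property at an a.s. finite stopping time: the shifted path has the law of the
process with initial distribution the law of `X_τ`. -/
theorem law_shift_mem {ν : Measure E} [IsProbabilityMeasure ν] {τ : Ω → WithTop ℝ≥0}
    (hτ : IsStoppingTime M.filtration τ) (hfin : ∀ᵐ ω ∂M.law ν, τ ω ≠ ⊤) {Λ : Set Ω}
    (hΛ : MeasurableSet Λ) :
    M.law ν {ω | M.θ (τ ω).untopA ω ∈ Λ} =
      M.law ((M.law ν).map fun ω => M.X (τ ω).untopA ω) Λ := by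
  have h := M.strongMarkov ν τ hτ Set.univ Λ MeasurableSet.univ hΛ
  have hfin' : ({ω | τ ω ≠ ⊤} : Set Ω) =ᵐ[ν.bind M.P] Set.univ := by
    filter_upwards [hfin] with ω hω
    exact eq_true hω
  rw [Set.univ_inter, Measure.restrict_congr_set hfin', Measure.restrict_univ,
    measure_congr (hfin'.inter (ae_eq_refl {ω | M.θ (τ ω).untopA ω ∈ Λ})), Set.univ_inter] at h
  rw [law, h, law, Measure.bind_apply hΛ M.P.aemeasurable,
    lintegral_map (M.P.measurable_coe hΛ) (M.measurable_X_untopA hτ)]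

variable {M}

/-- A finely closed set is entered at its hitting time. -/
theorem IsFinelyClosed.ae_mem_of_hit {R : Set (ℝ × ℝ)} (hRf : M.IsFinelyClosed R)
    (hRτ : M.IsAugmentedStoppingTime (M.hit R)) {ν : Measure E}
    [IsProbabilityMeasure ν] (hfin : ∀ᵐ ω ∂M.law ν, M.hit R ω ≠ ⊤) :
    ∀ᵐ ω ∂M.law ν, (M.X (M.hit R ω).untopA ω : ℝ × ℝ) ∈ R := by
  obtain ⟨τ, hτ, hτR⟩ := hRτ.exists_isStoppingTime ν
  have hτfin : ∀ᵐ ω ∂M.law ν, τ ω ≠ ⊤ := by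
    filter_upwards [hτR, hfin] with ω h1 h2
    rwa [h1]
  have hY := M.measurable_X_untopA hτ
  -- Restarting from the law of `X` at `τ`, the path must hit `R` at time `0`, so almost every
  -- starting point belongs to the fine closure.
  set ν' := (M.law ν).map fun ω => M.X (τ ω).untopA ω
  have hprob : IsProbabilityMeasure ν' := Measure.isProbabilityMeasure_map hY.aemeasurable
  obtain ⟨Λ, hΛm, hΛ⟩ := hRτ ν' hprob 0
  replace hΛm := M.filtration.le 0 _ hΛm
  -- The event `{τ_R ≤ 0}` need not be measurable, so the strong Markov property is applied to `Λᶜ`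
  -- and to a measurable null set `N` covering the discrepancy.
  set N := toMeasurable (M.law ν') {ω | ¬({ω | M.hit R ω ≤ (0 : ℝ≥0)} ω = Λ ω)}
  have hN : M.law ν' N = 0 := (measure_toMeasurable _).trans hΛ
  have hΛN : M.law ν' Λᶜ = 0 := by
    have hNτ := M.law_shift_mem hτ hτfin (measurableSet_toMeasurable _ _ : MeasurableSet N)
    rw [hN] at hNτ
    rw [← M.law_shift_mem hτ hτfin hΛm.compl]
    have hNτ' : ∀ᵐ ω ∂M.law ν, M.θ (τ ω).untopA ω ∉ N := measure_eq_zero_iff_ae_notMem.1 hNτ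
    refine measure_eq_zero_iff_ae_notMem.2 ?_
    filter_upwards [hNτ', hτR, hfin] with ω h1 h2 h3 h4
    refine h1 (subset_toMeasurable _ _ fun h5 => h4 ?_)
    rw [h2] at h5 ⊢
    exact (iff_of_eq h5).1 (M.hit_shift_hit h3)
  have hhit : ∀ᵐ ω ∂M.law ν', M.hit R ω = 0 := by
    filter_upwards [hΛ, measure_eq_zero_iff_ae_notMem.1 hΛN] with ω h1 h2
    exact nonpos_iff_eq_zero.1 ((iff_of_eq h1).2 (not_not.1 h2))
  have hmem : ∀ᵐ x : E ∂ν', (x : ℝ × ℝ) ∈ R := by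
    filter_upwards [Measure.ae_ae_of_ae_bind M.P.aemeasurable hhit] with x hx
    rw [← (hRf : M.fineClosure R = R)]
    exact Or.inr ⟨x.2, hx⟩
  filter_upwards [ae_of_ae_map hY.aemeasurable hmem, hτR] with ω h1 h2
  rwa [h2] at h1

theorem IsAugmentedStoppingTime.min {σ τ : Ω → WithTop ℝ≥0} (hσ : M.IsAugmentedStoppingTime σ)
    (hτ : M.IsAugmentedStoppingTime τ) :
    M.IsAugmentedStoppingTime fun ω => Min.min (σ ω) (τ ω) := by
  intro ν hν t
  obtain ⟨Λ, hΛm, hΛ⟩ := hσ ν hν t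
  obtain ⟨Λ', hΛm', hΛ'⟩ := hτ ν hν t
  refine ⟨Λ ∪ Λ', hΛm.union hΛm', ?_⟩
  have hmin : {ω | Min.min (σ ω) (τ ω) ≤ t} = {ω | σ ω ≤ t} ∪ {ω | τ ω ≤ t} :=
    Set.ext fun ω => (min_le_iff : Min.min (σ ω) (τ ω) ≤ t ↔ σ ω ≤ t ∨ τ ω ≤ t)
  rw [hmin]
  exact hΛ.union hΛ'

end JointMarkovProcess

/-- Switching between two random variables with law `μ` preserves the law if they enter the
switching set `K` simultaneously: since the probabilities of entering agree, one implication
suffices. -/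
theorem ProbabilityTheory.HasLaw.switch {Ω β : Type*} [MeasurableSpace Ω] [MeasurableSpace β]
    {P : Measure Ω} [IsFiniteMeasure P] {μ : Measure β} {f g h : Ω → β} {K : Set β}
    (hf : HasLaw f μ P) (hg : HasLaw g μ P) (hK : MeasurableSet K)
    (hfg : ∀ᵐ ω ∂P, f ω ∈ K → g ω ∈ K) (hhg : ∀ᵐ ω ∂P, f ω ∈ K → h ω = g ω)
    (hhf : ∀ᵐ ω ∂P, g ω ∉ K → h ω = f ω) : HasLaw h μ P := by
  classical
  have hF := hf.aemeasurable.nullMeasurableSet_preimage hK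
  have hFG : f ⁻¹' K =ᵐ[P] g ⁻¹' K := by
    refine ae_eq_of_ae_subset_of_measure_ge hfg ?_ hF (measure_ne_top _ _)
    exact ((hg.measure_eq hK).trans (hf.measure_eq hK).symm).le
  have hh : h =ᵐ[P] (hf.aemeasurable.mk f ⁻¹' K).piecewise (hg.aemeasurable.mk g)
      (hf.aemeasurable.mk f) := by
    filter_upwards [hf.aemeasurable.ae_eq_mk, hg.aemeasurable.ae_eq_mk, hFG, hhg, hhf]
      with ω h1 h2 h3 h4 h5
    have h3' : f ω ∈ K ↔ g ω ∈ K := iff_of_eq h3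
    by_cases hω : f ω ∈ K
    · rw [Set.piecewise_eq_of_mem _ _ _ (by rwa [Set.mem_preimage, ← h1]), ← h2, h4 hω]
    · rw [Set.piecewise_eq_of_notMem _ _ _ (by rwa [Set.mem_preimage, ← h1]), ← h1,
        h5 (h3'.not.1 hω)]
  have hhm : AEMeasurable h P := ⟨_, Measurable.piecewise
    (hf.aemeasurable.measurable_mk hK) hg.aemeasurable.measurable_mk
    hf.aemeasurable.measurable_mk, hh⟩
  refine ⟨hhm, Measure.ext fun H hH => ?_⟩
  -- Split `{h ∈ H}` along `{f ∈ K}` and `μ(H)` along `K`; the part in `K` is expressed through `g`,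
  -- the other through `f`.
  rw [Measure.map_apply_of_aemeasurable hhm hH, ← measure_inter_add_sdiff₀ _ hF,
    ← measure_inter_add_sdiff H hK, ← hg.map_eq,
    Measure.map_apply_of_aemeasurable hg.aemeasurable (hH.inter hK), hg.map_eq, ← hf.map_eq,
    Measure.map_apply_of_aemeasurable hf.aemeasurable (hH.diff hK)]
  congr 1
  · refine measure_congr ?_
    filter_upwards [hFG, hhg] with ω h1 h2
    have h1' : f ω ∈ K ↔ g ω ∈ K := iff_of_eq h1
    refine propext (?_ : h ω ∈ H ∧ f ω ∈ K ↔ g ω ∈ H ∧ g ω ∈ K)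
    constructor
    · rintro ⟨h3, h4⟩
      exact ⟨h2 h4 ▸ h3, h1'.1 h4⟩
    · rintro ⟨h3, h4⟩
      exact ⟨(h2 (h1'.2 h4)).symm ▸ h3, h1'.2 h4⟩
  · refine measure_congr ?_
    filter_upwards [hFG, hhf] with ω h1 h2
    have h1' : f ω ∈ K ↔ g ω ∈ K := iff_of_eq h1
    refine propext (?_ : h ω ∈ H ∧ f ω ∉ K ↔ f ω ∈ H ∧ f ω ∉ K)
    refine and_congr_left fun h3 => ?_
    rw [h2 (h1'.not.1 h3)]

theorem mainTheorem4 {E : Set (ℝ × ℝ)} {Ω : Type*} [MeasurableSpace Ω]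
    (M : JointMarkovProcess E Ω) (ν : Measure E) [IsProbabilityMeasure ν]
    (μ : Measure ℝ) [IsProbabilityMeasure μ] (R S : Set (ℝ × ℝ))
    (hRm : MeasurableSet R) (hSm : MeasurableSet S)
    (hR : IsBarrier R) (hS : IsBarrier S)
    (hRf : M.IsFinelyClosed R) (hSf : M.IsFinelyClosed S)
    (hRτ : M.IsAugmentedStoppingTime (M.hit R)) (hSτ : M.IsAugmentedStoppingTime (M.hit S))
    (hRμ : M.Embeds ν (M.hit R) μ) (hSμ : M.Embeds ν (M.hit S) μ) :
    M.IsAugmentedStoppingTime (M.hit (R ∪ S)) ∧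
      M.Embeds ν (M.hit (R ∪ S)) μ ∧
      ∀ ω, M.hit (R ∪ S) ω = min (M.hit R ω) (M.hit S ω) := by
  have hRS : M.hit (R ∪ S) = fun ω => min (M.hit R ω) (M.hit S ω) := funext (M.hit_union R S)
  refine ⟨hRS ▸ hRτ.min hSτ, ⟨?_, ?_⟩, M.hit_union R S⟩
  · filter_upwards [hRμ.1] with ω hω
    rw [hRS]
    exact ((min_le_left _ _).trans_lt hω.lt_top).ne
  set K : Set ℝ := {x | ∃ t, (t, x) ∈ S \ R}
  have hRmem := hRf.ae_mem_of_hit hRτ hRμ.1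
  have hSmem := hSf.ae_mem_of_hit hSτ hSμ.1
  have hSR : ∀ᵐ ω ∂M.law ν, stoppedValue M.B (M.hit R) ω ∈ K → M.hit S ω ≤ M.hit R ω := by
    filter_upwards [hRμ.1, hRmem] with ω hfin h ⟨t, htS, htR⟩
    refine M.hit_le_of_mem_untopA hfin ?_
    -- As `(t, x)` is outside the barrier `R`, the point of `R` reached at level `x` cannot lie to
    -- its left; the barrier property of `S` then applies.
    rcases lt_or_ge t (M.X (M.hit R ω).untopA ω : ℝ × ℝ).1 with hlt | hle
    · exact hS _ _ _ hlt htS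
    · rcases hle.lt_or_eq with hlt | heq
      · exact absurd (hR _ _ _ hlt h) htR
      · rw [← heq] at htR
        exact absurd h htR
  have hRS' : ∀ᵐ ω ∂M.law ν, stoppedValue M.B (M.hit S) ω ∉ K → M.hit R ω ≤ M.hit S ω := by
    filter_upwards [hSμ.1, hSmem] with ω hfin h hnK
    refine M.hit_le_of_mem_untopA hfin ?_
    by_contra hn
    exact hnK ⟨_, h, hn⟩
  refine hRμ.2.switch hSμ.2 (hR.measurableSet_gap hRm hSm hS) ?_ ?_ ?_
  -- If only `B_{τ_R}` were in `K`, both inequalities would hold and the two values of `B` would be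
  -- equal.
  · filter_upwards [hSR, hRS'] with ω h1 h2 h3
    by_contra h4
    have heq := le_antisymm (h1 h3) (h2 h4)
    rw [stoppedValue, heq] at h4
    exact h4 h3
  · filter_upwards [hSR] with ω h1 h2
    simp only [stoppedValue, hRS, min_eq_right (h1 h2)]
  · filter_upwards [hRS'] with ω h1 h2
    simp only [stoppedValue, hRS, min_eq_left (h1 h2)]
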